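/- Let $H=(V,E)$ be a hypergraph with finite node set $V$ and a non-empty set $E$ of hyperedges, each a non-empty subset of $V$, and suppose $H$ is strongly connected: $V\neq\emptyset$ and any two nodes are joined by a chain of nodes in which consecutive nodes lie in a common hyperedge. Let $p\ge 2$ be an integer (in particular, any $p$ with $2\le p\le M$, where $M$ is the maximum hyperedge size). Let $\widetilde H_p$ be the following weighted $p$-uniform hypergraph, whose hyperedges are multisets of size $p$. Its node set is $V'=V\cup\{\star\}$ if some hyperedge of $H$ has size less than $p$, and $V'=V$ otherwise, where $\star\notin V$ is an auxiliary node. Its hyperedges are: (i) for each $e\in E$ with $|e|<p$, the uplifted hyperedge consisting of the elements of $e$ and $m^\star=p-|e|$ copies of $\star$, with weight $\dfrac{m^\star!\,(p-m^\star)!}{p!}$; (ii) each $p$-element subset $s$ of a hyperedge of $H$ of size at least $p$, with weight $\#\{e\in E: |e|\ge p,\ s\subseteq e\}$. Let $T$ be its adjacency tensor, indexed by $(V')^p$: $T_{i_1\dots i_p}$ is the weight of the multiset $\{i_1,\dots,i_p\}$ if this is a hyperedge of $\widetilde H_p$, and $0$ otherwise. Theorem. (1) $\widetilde H_p$ is strongly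 connected, that is, $T$ is weakly irreducible: the non-negative matrix $M_{ij}=\sum_{j_3,\dots,j_p\in V'}|T_{i j j_3\dots j_p}|$ is irreducible. (2) The $p$-UPHEC (uplifted-projected $\mathcal H$-eigenvector centrality) exists: there are $\mathbf c\in\mathbb R^{V'}$ with all components positive and $\mu\in\mathbb R$ such that $$\sum_{i_2,\dots,i_p\in V'}T_{i i_2\dots i_p}\,c_{i_2}\cdots c_{i_p}=\mu\,c_i^{\,p-1}\qquad\text{for all } i\in V'.$$ (3) It is unique up to scaling: if $\mathbf c$ and $\mathbf c'$ are positive vectors that satisfy this equation, each for some real $\mu$, then $\mathbf c'=a\,\mathbf c$ for some $a>0$. -/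

import Mathlib

/-! ### Hypermatrices -/

/-- A real hypermatrix ("tensor") of order `m` whose indices range over `N`. -/
abbrev HyperTensor (N : Type*) (m : ℕ) : Type _ := (Fin m → N) → ℝ

namespace HyperTensor

variable {N : Type*} {m : ℕ}

open scoped Classical in
/-- Tensor apply: `(T c^{m-1})_i = ∑_{i₂, …, i_m} T_{i i₂ … i_m} c_{i₂} ⋯ c_{i_m}`; the sum runs
over all index tuples whose first index is `i`. -/
noncomputable def apply [Fintype N] [m.AtLeastTwo] (T : HyperTensor N m) (c : N → ℝ) : N → ℝ :=
  fun i => ∑ f : Fin m → N with f 0 = i, T f * ∏ l ∈ Finset.univ.erase (0 : Fin m), c (f l)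

open scoped Classical in
/-- The non-negative matrix `M_{ij} = ∑_{j₃, …, j_m} |T_{i j j₃ … j_m}|`. -/
noncomputable def assocMatrix [Fintype N] [m.AtLeastTwo] (T : HyperTensor N m) : Matrix N N ℝ :=
  fun i j => ∑ f : Fin m → N with f 0 = i ∧ f 1 = j, |T f|

/-- A tensor is weakly irreducible if its associated matrix is irreducible. -/
def IsWeaklyIrreducible [Fintype N] [m.AtLeastTwo] (T : HyperTensor N m) : Prop :=
  T.assocMatrix.IsIrreducible

/-- `c` is an `H`-eigenvector of `T` with `H`-eigenvalue `μ`: `c ≠ 0` and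
`T c^{m-1} = μ c^{[m-1]}`, with the componentwise power on the right. -/
def IsHEigenpair [Fintype N] [m.AtLeastTwo] (T : HyperTensor N m) (μ : ℝ) (c : N → ℝ) : Prop :=
  c ≠ 0 ∧ ∀ i, T.apply c i = μ * c i ^ (m - 1)

/-- A positive `H`-eigenvector: an `H`-eigenvector (for some real `H`-eigenvalue) all of whose
components are positive. -/
def IsPositiveHEigenvector [Fintype N] [m.AtLeastTwo] (T : HyperTensor N m) (c : N → ℝ) : Prop :=
  (∀ i, 0 < c i) ∧ ∃ μ : ℝ, T.IsHEigenpair μ c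

end HyperTensor

/-! ### Weighted uniform hypergraphs with multiset hyperedges -/

/-- An `m`-uniform weighted hypergraph on the nodes `N`. Its hyperedges are multisets of size `m`
(`Sym N m`); only the values of `weight` on hyperedges matter. -/
structure WeightedUniformHypergraph (N : Type*) (m : ℕ) where
  /-- The hyperedges. -/
  edges : Set (Sym N m)
  /-- The weight of a hyperedge. -/
  weight : Sym N m → ℝ

namespace WeightedUniformHypergraph

variable {N : Type*} {m : ℕ}

/-- The multiset `{f 0, …, f (m-1)}` of the entries of an index tuple. -/
def entries (f : Fin m → N) : Sym N m :=
  ⟨(Finset.univ : Finset (Fin m)).val.map f, by simp⟩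

open scoped Classical in
/-- The adjacency tensor: `T_{i₁ … i_m} = w({i₁, …, i_m})` if `{i₁, …, i_m}` is a hyperedge, and
`0` otherwise. -/
noncomputable def adjTensor (G : WeightedUniformHypergraph N m) : HyperTensor N m :=
  fun f => if entries f ∈ G.edges then G.weight (entries f) else 0

/-- A weighted uniform hypergraph is strongly connected if its adjacency tensor is weakly
irreducible. -/
def IsStronglyConnected [Fintype N] [m.AtLeastTwo] (G : WeightedUniformHypergraph N m) : Prop :=
  G.adjTensor.IsWeaklyIrreducible

end WeightedUniformHypergraph

/-! ### Uplifting and projecting a hypergraph to order `p` -/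

namespace Hypergraph

variable {α : Type*}

/-- A (not necessarily uniform) hypergraph is strongly connected if it has a node and any two of
its nodes are joined by a chain of nodes, consecutive ones sharing a hyperedge. -/
def IsStronglyConnected (H : Hypergraph α) : Prop :=
  H.vertexSet.Nonempty ∧
    ∀ x ∈ H.vertexSet, ∀ y ∈ H.vertexSet, Relation.ReflTransGen H.Adj x y

/-- The auxiliary node `⋆`: there is exactly one if some hyperedge has size less than `p` (so that
it has to be uplifted), and none otherwise. -/
abbrev AuxNode (H : Hypergraph α) (p : ℕ) : Type := PLift (∃ e ∈ H.edgeSet, e.ncard < p)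

/-- The nodes of the uniformised hypergraph: those of `H`, and `⋆` if it is needed. -/
abbrev UniformNode (H : Hypergraph α) (p : ℕ) : Type _ := H.vertexSet ⊕ H.AuxNode p

noncomputable instance (H : Hypergraph α) [Fintype H.vertexSet] (p : ℕ) :
    Fintype (H.UniformNode p) := by
  classical infer_instance

open scoped Classical in
/-- The members of a hyperedge, as a finite set of nodes. -/
noncomputable def members (H : Hypergraph α) [Fintype H.vertexSet] (e : Set α) :
    Finset H.vertexSet :=
  {v | (v : α) ∈ e}

/-- `s` is the uplift to size `p` of a hyperedge of size less than `p`: the members of `e`, each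
once, together with `p - |e|` copies of `⋆`. -/
def IsUplifted (H : Hypergraph α) [Fintype H.vertexSet] (p : ℕ) (s : Sym (H.UniformNode p) p) :
    Prop :=
  ∃ e ∈ H.edgeSet, e.ncard < p ∧ ∃ star : H.AuxNode p,
    (s : Multiset (H.UniformNode p)) =
      (H.members e).val.map Sum.inl + Multiset.replicate (p - e.ncard) (Sum.inr star)

/-- `s` is (as a multiset) a `p`-element subset of the hyperedge `e`. -/
def IsSubsetOf (H : Hypergraph α) [Fintype H.vertexSet] (p : ℕ) (s : Sym (H.UniformNode p) p)
    (e : Set α) : Prop :=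
  ∃ t ∈ (H.members e).powersetCard p,
    (s : Multiset (H.UniformNode p)) = t.val.map Sum.inl

/-- The number `m⋆` of copies of `⋆` in a multiset of nodes. -/
def starCount (H : Hypergraph α) (p : ℕ) (s : Sym (H.UniformNode p) p) : ℕ :=
  (s : Multiset (H.UniformNode p)).countP (fun x => x.isRight)

/-- The weighted `p`-uniform hypergraph obtained from `H` by uplifting and projecting.

Hyperedges: the uplifts of the hyperedges of `H` of size `< p`, the hyperedges of `H` of size `p`,
and all `p`-subsets of the hyperedges of `H` of size `> p`.

Weights: an uplifted hyperedge with `m⋆ > 0` copies of `⋆` weighs `m⋆! (p - m⋆)! / p!` (the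
`(p - m⋆)!` orderings of the original hyperedge are spread over the `p! / m⋆!` orderings of the
uplifted one). A hyperedge without `⋆` weighs the number of hyperedges of `H` of size `> p` that
contain it, plus `1` if it is itself a hyperedge of `H`; that is, the number of hyperedges of `H`
of size `≥ p` that contain it. -/
noncomputable def uniformise (H : Hypergraph α) [Fintype H.vertexSet] (p : ℕ) :
    WeightedUniformHypergraph (H.UniformNode p) p where
  edges := {s | H.IsUplifted p s ∨ ∃ e ∈ H.edgeSet, p ≤ e.ncard ∧ H.IsSubsetOf p s e}
  weight s :=
    if H.starCount p s = 0 then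
      ({e ∈ H.edgeSet | p ≤ e.ncard ∧ H.IsSubsetOf p s e}.ncard : ℝ)
    else
      ((H.starCount p s).factorial * (p - H.starCount p s).factorial : ℝ) / p.factorial

/-- `c` is a `p`-UPHEC vector of `H` (uplifted-projected `H`-eigenvector centrality): a positive
`H`-eigenvector of the weighted `p`-uniform hypergraph obtained by uplifting and projecting. -/
def IsUPHEC (H : Hypergraph α) [Fintype H.vertexSet] (p : ℕ) [p.AtLeastTwo]
    (c : H.UniformNode p → ℝ) : Prop :=
  (H.uniformise p).adjTensor.IsPositiveHEigenvector c

end Hypergraph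

/-! The adjacency tensor is nonnegative and symmetric, so once it is weakly irreducible, (2) and (3)
are Perron–Frobenius statements. Irreducibility: every hyperedge of the uniformised hypergraph has
positive weight and so links all its distinct nodes. Any two nodes sharing a hyperedge of `H` still
share one after uplifting or projecting, and `⋆` shares one with the members of any hyperedge that
is too small. Chains in `H` therefore survive and reach `⋆`. Existence is variational, thanks to
symmetry: maximise `T c^m` over nonnegative `c` with `∑ c_i^m = 1`. Weak irreducibility forces a
maximiser to be positive (`pos_of_forall_form_le`), so it is an interior critical point; the
Lagrange condition is the eigenvector equation, with the maximum as eigenvalue. Uniqueness compares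
`d` with the least multiple `a • c` above it: monotonicity equates the eigenvalues, and equality at
one index spreads to all by weak irreducibility. -/

/-- A nonnegative matrix over a nontrivial index type is irreducible if any two indices are joined
by a chain of positive entries. -/
theorem Matrix.isIrreducible_of_reflTransGen {n : Type*} [Nontrivial n] {A : Matrix n n ℝ}
    (hA : ∀ i j, 0 ≤ A i j)
    (h : ∀ i j, Relation.ReflTransGen (fun i j => 0 < A i j) i j) : A.IsIrreducible := by
  let : Quiver n := A.toQuiver
  have hpath : ∀ i j : n, Nonempty (Quiver.Path i j) := by
    intro i j
    induction h i j with
    | refl => exact ⟨Quiver.Path.nil⟩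
    | tail _ hbc ih => exact ih.map fun q => q.cons (PLift.up hbc)
  have hne : ∀ i j : n, i ≠ j → ∃ q : Quiver.Path i j, 0 < q.length := by
    intro i j hij
    obtain ⟨q⟩ := hpath i j
    exact ⟨q, Nat.pos_of_ne_zero fun h0 => hij (Quiver.Path.eq_of_length_zero q h0)⟩
  refine ⟨hA, fun i j => ?_⟩
  by_cases hij : i = j
  · subst hij
    -- Irreducibility asks for a path of positive length even from `i` to itself; a detour through
    -- another index supplies it.
    obtain ⟨k, hk⟩ := exists_ne i
    obtain ⟨q, hq⟩ := hne i k hk.symm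
    obtain ⟨r⟩ := hpath k i
    exact ⟨q.comp r, by rw [Quiver.Path.length_comp]; omega⟩
  · exact hne i j hij

theorem Fin.zero_ne_one_of_atLeastTwo {m : ℕ} [m.AtLeastTwo] : (0 : Fin m) ≠ 1 := by
  have h : 1 < m := Nat.AtLeastTwo.one_lt
  intro h0
  have := congrArg Fin.val h0
  rw [Fin.val_one', Nat.mod_eq_of_lt h] at this
  simp at this

namespace HyperTensor

variable {N : Type*} {m : ℕ}

/-- A tensor is symmetric if its entries do not depend on the order of the indices. -/
def IsSymm (T : HyperTensor N m) : Prop :=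
  ∀ (σ : Equiv.Perm (Fin m)) (f : Fin m → N), T (f ∘ σ) = T f

/-- The homogeneous form `T c^m` of a tensor. -/
noncomputable def form [Fintype N] (T : HyperTensor N m) (c : N → ℝ) : ℝ :=
  ∑ f : Fin m → N, T f * ∏ l, c (f l)

/-- A property of indices which holds somewhere and passes from the first to the second index of
the nonzero entries of a weakly irreducible tensor holds everywhere. -/
theorem IsWeaklyIrreducible.forall_of_closed [Fintype N] [m.AtLeastTwo] {T : HyperTensor N m}
    (hT : T.IsWeaklyIrreducible) {P : N → Prop} {i : N} (hi : P i)
    (hP : ∀ f, T f ≠ 0 → P (f 0) → P (f 1)) (j : N) : P j := by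
  classical
  let : Quiver N := T.assocMatrix.toQuiver
  obtain ⟨q, -⟩ := hT.connected i j
  induction q with
  | nil => exact hi
  | @cons b c q e ih =>
    have he : 0 < T.assocMatrix b c := e.down
    unfold assocMatrix at he
    obtain ⟨f, hf, hf0⟩ := Finset.exists_ne_zero_of_sum_ne_zero he.ne'
    simp only [Finset.mem_filter] at hf
    have := hP f (by simpa using hf0) (by rw [hf.2.1]; exact ih)
    rwa [hf.2.2] at this

/-! ### Uniqueness of positive eigenvectors by comparing ratios -/

section Uniqueness

variable [Fintype N] [m.AtLeastTwo] {T : HyperTensor N m}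

theorem apply_smul (T : HyperTensor N m) (a : ℝ) (c : N → ℝ) (i : N) :
    T.apply (a • c) i = a ^ (m - 1) * T.apply c i := by
  unfold apply
  rw [Finset.mul_sum]
  refine Finset.sum_congr rfl fun f _ => ?_
  simp only [Pi.smul_apply, smul_eq_mul, Finset.prod_mul_distrib, Finset.prod_const,
    Finset.card_erase_of_mem (Finset.mem_univ _), Finset.card_univ, Fintype.card_fin]
  ring

theorem apply_mono (hT : ∀ f, 0 ≤ T f) {c d : N → ℝ} (hc : ∀ i, 0 ≤ c i) (hcd : ∀ i, c i ≤ d i)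
    (i : N) : T.apply c i ≤ T.apply d i := by
  unfold apply
  gcongr with f _ l
  · exact hT f
  · exact fun l _ => hc _
  · exact hcd _

/-- The largest ratio of the entries of two positive vectors is attained. -/
theorem exists_le_smul_and_eq [Nonempty N] {c d : N → ℝ} (hc : ∀ i, 0 < c i) (hd : ∀ i, 0 < d i) :
    ∃ a : ℝ, 0 < a ∧ (∀ i, d i ≤ (a • c) i) ∧ ∃ i, d i = (a • c) i := by
  obtain ⟨i, hi⟩ := Finite.exists_max fun i => d i / c i
  refine ⟨d i / c i, div_pos (hd i) (hc i), fun j => ?_, i, ?_⟩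
  · exact (div_le_iff₀ (hc j)).1 (hi j)
  · simp [div_mul_cancel₀ _ (hc i).ne']

/-- At an index where `d` touches the least multiple `a • c` above it, monotonicity of `T.apply`
compares the two eigenvalue equations with the same positive power on both sides. Exchanging `c` and
`d` gives equality. -/
theorem eigenvalue_le [Nonempty N] (hT : ∀ f, 0 ≤ T f) {c d : N → ℝ} {μ ν : ℝ}
    (hc : ∀ i, 0 < c i) (hd : ∀ i, 0 < d i) (hcμ : ∀ i, T.apply c i = μ * c i ^ (m - 1))
    (hdν : ∀ i, T.apply d i = ν * d i ^ (m - 1)) : ν ≤ μ := by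
  obtain ⟨a, -, hle, i, hi⟩ := exists_le_smul_and_eq hc hd
  have h := apply_mono hT (fun j => (hd j).le) hle i
  rw [apply_smul, hcμ, hdν, hi] at h
  have h2 : 0 < (a • c) i ^ (m - 1) := by rw [← hi]; exact pow_pos (hd i) _
  refine le_of_mul_le_mul_right ?_ h2
  calc ν * (a • c) i ^ (m - 1) ≤ a ^ (m - 1) * (μ * c i ^ (m - 1)) := h
    _ = μ * (a • c) i ^ (m - 1) := by simp only [Pi.smul_apply, smul_eq_mul, mul_pow]; ring

/-- Positive `H`-eigenvectors of a nonnegative weakly irreducible tensor are unique up to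
scaling. -/
theorem IsPositiveHEigenvector.exists_eq_smul [Nonempty N] (hT : ∀ f, 0 ≤ T f)
    (hirr : T.IsWeaklyIrreducible) {c d : N → ℝ} (hc : T.IsPositiveHEigenvector c)
    (hd : T.IsPositiveHEigenvector d) : ∃ a : ℝ, 0 < a ∧ d = a • c := by
  classical
  obtain ⟨hc, μ, -, hcμ⟩ := hc
  obtain ⟨hd, ν, -, hdν⟩ := hd
  obtain rfl : ν = μ :=
    (eigenvalue_le hT hc hd hcμ hdν).antisymm (eigenvalue_le hT hd hc hdν hcμ)
  obtain ⟨a, ha, hle, i, hi⟩ := exists_le_smul_and_eq hc hd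
  refine ⟨a, ha, funext (hirr.forall_of_closed hi fun f hf h0 => ?_)⟩
  have heq : T.apply d (f 0) = T.apply (a • c) (f 0) := by
    rw [apply_smul, hcμ, hdν, h0, Pi.smul_apply, smul_eq_mul, mul_pow]; ring
  -- The two sums agree and are ordered term by term, so all their terms agree. Where `T f ≠ 0` the
  -- products agree, and since all factors are positive, a strict inequality at slot `1` would make
  -- them differ.
  unfold apply at heq
  rw [Finset.sum_eq_sum_iff_of_le] at heq
  · have hprod := mul_left_cancel₀ hf (heq f (by simp))
    by_contra hne
    refine hprod.not_lt (Finset.prod_lt_prod (fun l _ => hd _) (fun l _ => hle _) ⟨1, ?_, ?_⟩)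
    · exact Finset.mem_erase.2 ⟨Fin.zero_ne_one_of_atLeastTwo.symm, Finset.mem_univ _⟩
    · exact lt_of_le_of_ne (hle _) hne
  · intro g _
    gcongr with l
    · exact hT g
    · exact fun l _ => (hd _).le
    · exact hle _

end Uniqueness

/-! ### Existence of a positive eigenvector by maximising the form -/

section Existence

variable [Fintype N] {T : HyperTensor N m}

theorem form_smul (T : HyperTensor N m) (a : ℝ) (c : N → ℝ) :
    T.form (a • c) = a ^ m * T.form c := by
  unfold form
  rw [Finset.mul_sum]
  refine Finset.sum_congr rfl fun f _ => ?_
  simp only [Pi.smul_apply, smul_eq_mul, Finset.prod_mul_distrib, Finset.prod_const,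
    Finset.card_univ, Fintype.card_fin]
  ring

theorem continuous_form (T : HyperTensor N m) : Continuous T.form := by
  unfold form
  fun_prop

open scoped Classical in
/-- Partial derivatives of the form of a symmetric tensor. -/
theorem IsSymm.hasDerivAt_form [m.AtLeastTwo] (hT : T.IsSymm) (c : N → ℝ) (i : N) :
    HasDerivAt (fun t : ℝ => T.form (c + t • Pi.single i 1)) (m * T.apply c i) 0 := by
  have hx : ∀ j, HasDerivAt (fun t : ℝ => (c + t • (Pi.single i 1 : N → ℝ)) j)
      (if j = i then 1 else 0) 0 := by
    intro j
    have := ((hasDerivAt_id (0 : ℝ)).mul_const ((Pi.single i 1 : N → ℝ) j)).const_add (c j)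
    simpa [Pi.single_apply] using this
  have hsum : HasDerivAt (fun t : ℝ => T.form (c + t • Pi.single i 1))
      (∑ f : Fin m → N, T f * ∑ l, (∏ k ∈ Finset.univ.erase l, c (f k)) *
        (if f l = i then 1 else 0)) 0 := by
    unfold form
    refine HasDerivAt.fun_sum fun f _ => HasDerivAt.const_mul _ ?_
    have := HasDerivAt.fun_finsetProd (u := Finset.univ) (x := (0 : ℝ))
      (f := fun l t => (c + t • (Pi.single i 1 : N → ℝ)) (f l))
      (f' := fun l => if f l = i then 1 else 0) fun l _ => hx (f l)
    simpa using this
  convert hsum using 1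
  have hl : ∀ l : Fin m, ∑ f : Fin m → N, T f * ((∏ k ∈ Finset.univ.erase l, c (f k)) *
      (if f l = i then 1 else 0)) = T.apply c i := by
    intro l
    unfold apply
    -- Swapping slots `0` and `l` turns the term of the product rule at slot `l` into that at slot
    -- `0`; by symmetry all `m` terms are equal.
    rw [Finset.sum_filter, ← (Equiv.arrowCongr (Equiv.swap 0 l) (Equiv.refl N)).sum_comp]
    refine Finset.sum_congr rfl fun f _ => ?_
    have h1 : (Equiv.arrowCongr (Equiv.swap 0 l) (Equiv.refl N)) f = f ∘ Equiv.swap 0 l := by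
      ext; simp [Equiv.arrowCongr]
    rw [h1, hT]
    have h2 : ∏ k ∈ Finset.univ.erase l, c ((f ∘ Equiv.swap 0 l) k) =
        ∏ k ∈ Finset.univ.erase 0, c (f k) := by
      refine Finset.prod_bij (fun k _ => Equiv.swap 0 l k) ?_ ?_ ?_ ?_
      · intro k hk
        simp only [Finset.mem_erase, Finset.mem_univ, and_true] at hk ⊢
        rwa [Ne, Equiv.swap_apply_eq_iff, Equiv.swap_apply_left]
      · intro _ _ _ _ h
        exact (Equiv.swap 0 l).injective h
      · intro k hk
        simp only [Finset.mem_erase, Finset.mem_univ, and_true] at hk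
        refine ⟨Equiv.swap 0 l k, ?_, by simp⟩
        simp only [Finset.mem_erase, Finset.mem_univ, and_true]
        rwa [Ne, Equiv.swap_apply_eq_iff, Equiv.swap_apply_right]
      · intro _ _
        rfl
    rw [h2]
    simp
  simp_rw [Finset.mul_sum]
  rw [Finset.sum_comm, Finset.sum_congr rfl fun l _ => hl l]
  simp

/-- The form of a tensor, relative to `∑ i, c i ^ m`, is maximised on the nonnegative orthant. -/
theorem exists_form_le [Nonempty N] [NeZero m] (T : HyperTensor N m) :
    ∃ c : N → ℝ, (∀ i, 0 ≤ c i) ∧ ∑ i, c i ^ m = 1 ∧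
      ∀ x : N → ℝ, (∀ i, 0 ≤ x i) → T.form x ≤ T.form c * ∑ i, x i ^ m := by
  classical
  have hm : m ≠ 0 := NeZero.ne m
  let K : Set (N → ℝ) := {c | (∀ i, 0 ≤ c i) ∧ ∑ i, c i ^ m = 1}
  have hKc : IsCompact K := by
    refine (isCompact_univ_pi fun _ : N => isCompact_Icc (a := (0 : ℝ)) (b := 1)).of_isClosed_subset
      ?_ ?_
    · refine IsClosed.inter (s₁ := {c : N → ℝ | ∀ i, 0 ≤ c i}) ?_ ?_
      · simp only [Set.ofPred_forall]
        exact isClosed_iInter fun i => isClosed_le continuous_const (continuous_apply i)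
      · exact isClosed_eq (by fun_prop) continuous_const
    · rintro c ⟨h0, h1⟩ i -
      refine ⟨h0 i, (pow_le_one_iff_of_nonneg (h0 i) hm).1 ?_⟩
      rw [← h1]
      exact Finset.single_le_sum (f := fun i => c i ^ m) (fun j _ => pow_nonneg (h0 j) m)
        (Finset.mem_univ i)
  have hKn : K.Nonempty := by
    obtain ⟨i⟩ := ‹Nonempty N›
    refine ⟨Pi.single i 1, fun j => ?_, ?_⟩
    · by_cases h : j = i <;> simp [h]
    · simp [Pi.single_apply, ite_pow, hm]
  obtain ⟨c, ⟨hc0, hc1⟩, hmax⟩ := hKc.exists_isMaxOn hKn T.continuous_form.continuousOn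
  refine ⟨c, hc0, hc1, fun x hx => ?_⟩
  have hs : 0 ≤ ∑ i, x i ^ m := Finset.sum_nonneg fun i _ => pow_nonneg (hx i) m
  -- `t` is the `m`-norm of `x`; homogeneity reduces the bound to `t⁻¹ • x`, which lies in `K`.
  obtain ⟨t, ht, hts⟩ : ∃ t : ℝ, 0 ≤ t ∧ t ^ m = ∑ i, x i ^ m :=
    ⟨_, Real.rpow_nonneg hs _, Real.rpow_inv_natCast_pow hs hm⟩
  rcases ht.eq_or_lt with rfl | ht
  · have hx0 : x = (0 : ℝ) • x := by
      funext i
      rw [zero_pow hm] at hts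
      have := (Finset.sum_eq_zero_iff_of_nonneg fun i _ => pow_nonneg (hx i) m).1 hts.symm i
        (Finset.mem_univ i)
      simpa using pow_eq_zero_iff hm |>.1 this
    rw [← hts, hx0, form_smul, zero_pow hm]
    simp
  · have hy : t⁻¹ • x ∈ K := by
      refine ⟨fun i => mul_nonneg (inv_nonneg.2 ht.le) (hx i), ?_⟩
      simp only [Pi.smul_apply, smul_eq_mul, mul_pow]
      rw [← Finset.mul_sum, ← hts, ← mul_pow, inv_mul_cancel₀ ht.ne', one_pow]
    have h := hmax hy
    have hxy : x = t • t⁻¹ • x := by rw [smul_smul, mul_inv_cancel₀ ht.ne', one_smul]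
    rw [← hts, hxy, form_smul, mul_comm]
    exact mul_le_mul_of_nonneg_right h (pow_nonneg ht.le m)

/-- A maximiser of the form of a nonnegative weakly irreducible tensor is positive. -/
theorem pos_of_forall_form_le [m.AtLeastTwo] (hT : ∀ f, 0 ≤ T f) (hirr : T.IsWeaklyIrreducible)
    {c : N → ℝ} (hc : ∀ i, 0 ≤ c i) (hc1 : ∑ i, c i ^ m = 1)
    (hmax : ∀ x : N → ℝ, (∀ i, 0 ≤ x i) → T.form x ≤ T.form c * ∑ i, x i ^ m) (i : N) :
    0 < c i := by
  classical
  have hm : m ≠ 0 := NeZero.ne m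
  by_contra hi
  have hi : c i = 0 := le_antisymm (not_lt.1 hi) (hc i)
  -- Otherwise the zero set of `c` would be closed under the links of `T`, hence everything.
  have hex : ∃ f, T f ≠ 0 ∧ c (f 0) = 0 ∧ c (f 1) ≠ 0 := by
    by_contra! hcl
    have h0 : ∀ j, c j = 0 := hirr.forall_of_closed (P := fun j => c j = 0) hi hcl
    simp [h0, hm] at hc1
  obtain ⟨f, hf, hf0, hf1⟩ := hex
  have hTf : 0 < T f := lt_of_le_of_ne (hT f) hf.symm
  have hδ : 0 < c (f 1) := lt_of_le_of_ne (hc _) (Ne.symm hf1)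
  let n : ℝ := ({i | c i = 0} : Finset N).card
  -- Raise the `n` zero entries of `c` to `ε`. The entry `f` gains at least `T f * c (f 1) * ε ^ (m
  -- - 1)`, while the bound on the form grows only by `T.form c * n * ε ^ m`; a small `ε`
  -- contradicts maximality.
  obtain ⟨ε, hεc, hεn, hε⟩ : ∃ ε : ℝ, (∀ i, 0 < c i → ε < c i) ∧
      T.form c * n * ε < T f * c (f 1) ∧ 0 < ε := by
    have h1 : ∀ᶠ ε in nhdsWithin (0 : ℝ) (Set.Ioi 0), ∀ i, 0 < c i → ε < c i := by
      refine Filter.eventually_all.2 fun i => ?_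
      by_cases h : 0 < c i
      · exact ((eventually_lt_nhds h).filter_mono nhdsWithin_le_nhds).mono fun _ h _ => h
      · exact Filter.Eventually.of_forall fun _ h' => absurd h' h
    have h2 : ∀ᶠ ε in nhdsWithin (0 : ℝ) (Set.Ioi 0), T.form c * n * ε < T f * c (f 1) := by
      refine Filter.Eventually.filter_mono nhdsWithin_le_nhds ?_
      have : Filter.Tendsto (fun ε : ℝ => T.form c * n * ε) (nhds 0) (nhds (T.form c * n * 0)) :=
        (continuous_const.mul continuous_id).tendsto 0
      exact this.eventually_lt_const (by simpa using mul_pos hTf hδ)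
    exact (h1.and (h2.and self_mem_nhdsWithin)).exists
  let x : N → ℝ := fun i => if c i = 0 then ε else c i
  have hcx : ∀ i, c i ≤ x i := by
    intro i
    by_cases h : c i = 0 <;> simp [x, h, hε.le]
  have hεx : ∀ i, ε ≤ x i := by
    intro i
    by_cases h : c i = 0
    · simp [x, h]
    · simpa [x, h] using (hεc i (lt_of_le_of_ne (hc i) (Ne.symm h))).le
  have hxsum : ∑ i, x i ^ m = 1 + n * ε ^ m := by
    have : ∀ i, x i ^ m = c i ^ m + if c i = 0 then ε ^ m else 0 := by
      intro i
      by_cases h : c i = 0 <;> simp [x, h, hm]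
    simp_rw [this]
    rw [Finset.sum_add_distrib, hc1, ← Finset.sum_filter, Finset.sum_const, nsmul_eq_mul]
  have hgain : T.form c + T f * (c (f 1) * ε ^ (m - 1)) ≤ T.form x := by
    have hfx : c (f 1) * ε ^ (m - 1) ≤ ∏ l, x (f l) := by
      rw [← Finset.mul_prod_erase _ _ (Finset.mem_univ (1 : Fin m))]
      have : ε ^ (m - 1) ≤ ∏ l ∈ Finset.univ.erase (1 : Fin m), x (f l) := by
        calc ε ^ (m - 1) = ∏ l ∈ Finset.univ.erase (1 : Fin m), ε := by simp
          _ ≤ _ := Finset.prod_le_prod (fun _ _ => hε.le) fun l _ => hεx _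
      exact mul_le_mul (hcx _) this (by positivity) ((hc _).trans (hcx _))
    have hfc : ∏ l, c (f l) = 0 := Finset.prod_eq_zero (Finset.mem_univ 0) hf0
    unfold form
    rw [← Finset.add_sum_erase _ _ (Finset.mem_univ f),
      ← Finset.add_sum_erase _ (fun f => T f * ∏ l, x (f l)) (Finset.mem_univ f), hfc, mul_zero,
      zero_add, add_comm]
    refine add_le_add (mul_le_mul_of_nonneg_left hfx (hT f)) (Finset.sum_le_sum fun g _ => ?_)
    exact mul_le_mul_of_nonneg_left
      (Finset.prod_le_prod (fun l _ => hc _) fun l _ => hcx _) (hT g)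
  have hle := hmax x fun i => (hc i).trans (hcx i)
  have hpow : ε ^ m = ε ^ (m - 1) * ε := by
    rw [← pow_succ, Nat.sub_add_cancel (Nat.pos_of_ne_zero hm)]
  rw [hxsum, hpow] at hle
  have hpos : 0 < ε ^ (m - 1) := pow_pos hε _
  have := mul_lt_mul_of_pos_right hεn hpos
  nlinarith

/-- A symmetric nonnegative weakly irreducible tensor has a positive `H`-eigenvector. -/
theorem IsSymm.exists_isPositiveHEigenvector [Nonempty N] [m.AtLeastTwo] (hsymm : T.IsSymm)
    (hT : ∀ f, 0 ≤ T f) (hirr : T.IsWeaklyIrreducible) :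
    ∃ c, T.IsPositiveHEigenvector c := by
  classical
  obtain ⟨c, hc, hc1, hmax⟩ := T.exists_form_le
  have hpos := pos_of_forall_form_le hT hirr hc hc1 hmax
  refine ⟨c, hpos, T.form c, ?_, fun i => ?_⟩
  · obtain ⟨i⟩ := ‹Nonempty N›
    exact fun h => (hpos i).ne' (congrFun h i)
  have hm : (m : ℝ) ≠ 0 := Nat.cast_ne_zero.2 (NeZero.ne m)
  -- `g` vanishes at `0`. As `c` is positive, small `t` of either sign stay in the orthant, so `g ≤
  -- 0` near `0` and its derivative there is zero.
  let g : ℝ → ℝ := fun t =>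
    T.form (c + t • Pi.single i 1) - T.form c * ∑ j, (c + t • (Pi.single i 1 : N → ℝ)) j ^ m
  have hg : HasDerivAt g (m * T.apply c i - T.form c * (m * c i ^ (m - 1))) 0 := by
    refine (hsymm.hasDerivAt_form c i).sub (HasDerivAt.const_mul _ ?_)
    have hj : ∀ j ∈ Finset.univ, HasDerivAt
        (fun t : ℝ => (c + t • (Pi.single i 1 : N → ℝ)) j ^ m)
        (if j = i then m * c i ^ (m - 1) else 0) 0 := by
      intro j _
      have := (((hasDerivAt_id (0 : ℝ)).mul_const ((Pi.single i 1 : N → ℝ) j)).const_add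
        (c j)).fun_pow m
      by_cases h : j = i
      · subst h
        simpa using this
      · simpa [h] using this
    simpa using HasDerivAt.fun_sum hj
  have hloc : IsLocalMax g 0 := by
    have h0 : g 0 = 0 := by simp [g, hc1]
    have hnn : ∀ᶠ t in nhds (0 : ℝ), ∀ j, 0 ≤ (c + t • (Pi.single i 1 : N → ℝ)) j := by
      refine Filter.eventually_all.2 fun j => ?_
      have : Filter.Tendsto (fun t : ℝ => (c + t • (Pi.single i 1 : N → ℝ)) j) (nhds 0)
          (nhds (c j)) := by
        have h : Continuous fun t : ℝ => (c + t • (Pi.single i 1 : N → ℝ)) j := by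
          simp only [Pi.add_apply, Pi.smul_apply, smul_eq_mul]
          fun_prop
        simpa using h.tendsto 0
      exact (this.eventually_const_lt (hpos j)).mono fun _ h => h.le
    filter_upwards [hnn] with t ht
    rw [h0]
    exact sub_nonpos.2 (hmax _ ht)
  have := hloc.hasDerivAt_eq_zero hg
  refine mul_left_cancel₀ hm ?_
  linarith

end Existence

end HyperTensor

/-! ### Adjacency tensors: symmetry and links within a hyperedge -/

namespace WeightedUniformHypergraph

variable {N : Type*} {m : ℕ}

theorem entries_comp_perm (f : Fin m → N) (σ : Equiv.Perm (Fin m)) :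
    entries (f ∘ σ) = entries f := by
  refine Subtype.ext ?_
  change Multiset.map (f ∘ σ) Finset.univ.val = Multiset.map f Finset.univ.val
  rw [← Multiset.map_map]
  congr 1
  simp

theorem adjTensor_isSymm (G : WeightedUniformHypergraph N m) : G.adjTensor.IsSymm := by
  intro σ f
  unfold adjTensor
  rw [entries_comp_perm]

theorem exists_entries_eq [m.AtLeastTwo] (s : Sym N m) {x y : N} (hx : x ∈ s) (hy : y ∈ s)
    (hxy : x ≠ y) : ∃ f : Fin m → N, entries f = s ∧ f 0 = x ∧ f 1 = y := by
  classical
  obtain ⟨s, hs⟩ := s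
  obtain ⟨s', rfl⟩ := Multiset.exists_cons_of_mem (show x ∈ s from hx)
  have hy' : y ∈ s' := (Multiset.mem_cons.1 (show y ∈ x ::ₘ s' from hy)).resolve_left hxy.symm
  obtain ⟨r, rfl⟩ := Multiset.exists_cons_of_mem hy'
  obtain ⟨L, rfl⟩ := Quot.exists_rep r
  obtain rfl : (x :: y :: L).length = m := hs
  refine ⟨(x :: y :: L).get, Subtype.ext ?_, ?_, ?_⟩
  · change Multiset.map (x :: y :: L).get Finset.univ.val = _
    rw [Fin.univ_val_map, List.ofFn_get]
    rfl
  · rfl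
  · rfl

/-- Distinct nodes of a hyperedge of positive weight are linked in the associated matrix. -/
theorem assocMatrix_adjTensor_pos [Fintype N] [m.AtLeastTwo] {G : WeightedUniformHypergraph N m}
    {s : Sym N m} (hs : s ∈ G.edges) (hw : 0 < G.weight s) {x y : N} (hx : x ∈ s) (hy : y ∈ s)
    (hxy : x ≠ y) : 0 < G.adjTensor.assocMatrix x y := by
  classical
  obtain ⟨f, rfl, h0, h1⟩ := exists_entries_eq s hx hy hxy
  unfold HyperTensor.assocMatrix
  refine Finset.sum_pos' (fun _ _ => abs_nonneg _)
    ⟨f, Finset.mem_filter.2 ⟨Finset.mem_univ _, h0, h1⟩, ?_⟩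
  rw [abs_pos, adjTensor, if_pos hs]
  exact hw.ne'

end WeightedUniformHypergraph

/-! ### Strong connectedness of the uniformised hypergraph -/

namespace Hypergraph

variable {α : Type*} (H : Hypergraph α) [Fintype H.vertexSet] {p : ℕ}

theorem uniformise_weight_nonneg (s : Sym (H.UniformNode p) p) :
    0 ≤ (H.uniformise p).weight s := by
  simp only [uniformise]
  split_ifs <;> positivity

theorem uniformise_adjTensor_nonneg (f : Fin p → H.UniformNode p) :
    0 ≤ (H.uniformise p).adjTensor f := by
  unfold WeightedUniformHypergraph.adjTensor
  split_ifs
  · exact H.uniformise_weight_nonneg _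
  · exact le_rfl

theorem edgeSet_finite : H.edgeSet.Finite :=
  (Set.toFinite H.vertexSet).finite_subsets.subset fun _ he => H.subset_vertexSet_of_mem_edgeSet' he

theorem mem_members {e : Set α} {v : H.vertexSet} : v ∈ H.members e ↔ (v : α) ∈ e := by
  simp [members]

theorem card_members {e : Set α} (he : e ∈ H.edgeSet) : (H.members e).card = e.ncard := by
  classical
  rw [← Set.ncard_coe_finset]
  have : e = Subtype.val '' (H.members e : Set H.vertexSet) := by
    ext v
    simp only [Set.mem_image, Finset.mem_coe, mem_members]
    exact ⟨fun hv => ⟨⟨v, H.subset_vertexSet_of_mem_edgeSet' he hv⟩, hv, rfl⟩,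
      by rintro ⟨w, hw, rfl⟩; exact hw⟩
  conv_rhs => rw [this]
  exact (Set.ncard_image_of_injective _ Subtype.val_injective).symm

/-- An uplift contains at least one `⋆`, so the counting weight applies only to subsets of large
hyperedges, each counted at least once. -/
theorem uniformise_weight_pos {s : Sym (H.UniformNode p) p} (hs : s ∈ (H.uniformise p).edges) :
    0 < (H.uniformise p).weight s := by
  simp only [uniformise]
  split_ifs with h
  · rcases hs with ⟨e, he, hep, star, hse⟩ | ⟨e, he, hpe, hse⟩
    · exfalso
      refine Multiset.countP_eq_zero.1 h (Sum.inr star) ?_ rfl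
      rw [hse]
      exact Multiset.mem_add.2 (Or.inr (Multiset.mem_replicate.2 ⟨by omega, rfl⟩))
    · refine Nat.cast_pos.2 ((Set.ncard_pos (H.edgeSet_finite.subset fun _ h => h.1)).2
        ⟨e, he, hpe, hse⟩)
  · positivity

/-- The uplift of a hyperedge of size less than `p`. -/
theorem exists_edge_of_ncard_lt {e : Set α} (he : e ∈ H.edgeSet) (hep : e.ncard < p)
    (star : H.AuxNode p) : ∃ s ∈ (H.uniformise p).edges,
      (∀ v : H.vertexSet, (v : α) ∈ e → Sum.inl v ∈ s) ∧ Sum.inr star ∈ s := by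
  refine ⟨⟨(H.members e).val.map Sum.inl + Multiset.replicate (p - e.ncard) (Sum.inr star), ?_⟩,
    Or.inl ⟨e, he, hep, star, rfl⟩, fun v hv => ?_, ?_⟩
  · simp only [Multiset.card_add, Multiset.card_map, Finset.card_val, Multiset.card_replicate,
      H.card_members he]
    omega
  · exact Multiset.mem_add.2 (Or.inl (Multiset.mem_map_of_mem _ (H.mem_members.2 hv)))
  · exact Multiset.mem_add.2 (Or.inr (Multiset.mem_replicate.2 ⟨by omega, rfl⟩))

theorem exists_edge_of_mem [p.AtLeastTwo] {e : Set α} (he : e ∈ H.edgeSet) {v w : H.vertexSet}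
    (hv : (v : α) ∈ e) (hw : (w : α) ∈ e) :
    ∃ s ∈ (H.uniformise p).edges, Sum.inl v ∈ s ∧ Sum.inl w ∈ s := by
  classical
  by_cases hep : e.ncard < p
  · obtain ⟨s, hs, h, -⟩ := H.exists_edge_of_ncard_lt he hep ⟨e, he, hep⟩
    exact ⟨s, hs, h v hv, h w hw⟩
  · have hp : 2 ≤ p := Nat.AtLeastTwo.prop
    -- Since `p ≥ 2`, the set `{v, w}` extends to a `p`-subset of the large hyperedge; `v = w` is
    -- allowed.
    obtain ⟨t, hvt, hte, ht⟩ := Finset.exists_subsuperset_card_eq (s := {v, w})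
      (t := H.members e) (n := p) (by simp [Finset.insert_subset_iff, mem_members, hv, hw])
      (Finset.card_le_two.trans hp) (by rw [H.card_members he]; omega)
    refine ⟨⟨t.val.map Sum.inl, by simpa using ht⟩, Or.inr ⟨e, he, not_lt.1 hep, t,
      Finset.mem_powersetCard.2 ⟨hte, ht⟩, rfl⟩, ?_, ?_⟩ <;>
      exact Multiset.mem_map_of_mem _ (hvt (by simp))

/-- Uplifting and projecting a strongly connected hypergraph gives a strongly connected uniform
hypergraph. -/
theorem IsStronglyConnected.uniformise {H : Hypergraph α} [Fintype H.vertexSet]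
    (hconn : H.IsStronglyConnected) (hE : H.edgeSet.Nonempty) (hne : ∀ e ∈ H.edgeSet, e.Nonempty)
    (p : ℕ) [p.AtLeastTwo] : (H.uniformise p).IsStronglyConnected := by
  classical
  let R : H.UniformNode p → H.UniformNode p → Prop :=
    fun i j => 0 < (H.uniformise p).adjTensor.assocMatrix i j
  have hR : ∀ s ∈ (H.uniformise p).edges, ∀ x ∈ s, ∀ y ∈ s, Relation.ReflTransGen R x y := by
    intro s hs x hx y hy
    by_cases hxy : x = y
    · rw [hxy]
    · exact .single (WeightedUniformHypergraph.assocMatrix_adjTensor_pos hs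
        (H.uniformise_weight_pos hs) hx hy hxy)
  have hVV : ∀ v w : H.vertexSet, Relation.ReflTransGen R (Sum.inl v) (Sum.inl w) := by
    rintro ⟨v, hv⟩ ⟨w, hw⟩
    have := hconn.2 v hv w hw
    induction this with
    | refl => exact .refl
    | tail _ hbc ih =>
      obtain ⟨e, he, hb, hc⟩ := hbc
      have hbV := H.subset_vertexSet_of_mem_edgeSet' he hb
      obtain ⟨s, hs, hbs, hcs⟩ := H.exists_edge_of_mem (p := p) he (v := ⟨_, hbV⟩)
        (w := ⟨_, hw⟩) hb hc
      exact (ih hbV).trans (hR s hs _ hbs _ hcs)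
  have hstar : ∀ star : H.AuxNode p, ∃ v : H.vertexSet,
      Relation.ReflTransGen R (Sum.inl v) (Sum.inr star) ∧
        Relation.ReflTransGen R (Sum.inr star) (Sum.inl v) := by
    intro star
    obtain ⟨e, he, hep⟩ := star.down
    obtain ⟨v, hv⟩ := hne e he
    obtain ⟨s, hs, h, h'⟩ := H.exists_edge_of_ncard_lt he hep star
    have hvs := h ⟨v, H.subset_vertexSet_of_mem_edgeSet' he hv⟩ hv
    exact ⟨_, hR s hs _ hvs _ h', hR s hs _ h' _ hvs⟩
  -- A hyperedge of size less than `p` brings in `⋆` beside a node of `H`; any other has at least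
  -- two members.
  have hnt : Nontrivial (H.UniformNode p) := by
    obtain ⟨e, he⟩ := hE
    by_cases hep : e.ncard < p
    · obtain ⟨v, hv⟩ := hconn.1
      exact ⟨Sum.inl ⟨v, hv⟩, Sum.inr ⟨e, he, hep⟩, by simp⟩
    · have hp : 2 ≤ p := Nat.AtLeastTwo.prop
      rw [← H.card_members he] at hep
      obtain ⟨v, -, w, -, hvw⟩ := Finset.one_lt_card.1 (show 1 < (H.members e).card by omega)
      exact ⟨Sum.inl v, Sum.inl w, by simpa using hvw⟩
  refine Matrix.isIrreducible_of_reflTransGen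
    (fun i j => Finset.sum_nonneg fun _ _ => abs_nonneg _) ?_
  rintro (v | a) (w | b)
  · exact hVV v w
  · obtain ⟨w, hw, -⟩ := hstar b
    exact (hVV v w).trans hw
  · obtain ⟨v, -, hv⟩ := hstar a
    exact hv.trans (hVV v w)
  · rw [Subsingleton.elim a b]

end Hypergraph

theorem mainTheorem2 {α : Type*} (H : Hypergraph α) [Fintype H.vertexSet]
    (hE : H.edgeSet.Nonempty) (hne : ∀ e ∈ H.edgeSet, e.Nonempty)
    (hconn : H.IsStronglyConnected) (p : ℕ) [p.AtLeastTwo] :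
    (H.uniformise p).IsStronglyConnected ∧
      (∃ c : H.UniformNode p → ℝ, H.IsUPHEC p c) ∧
      ∀ c c' : H.UniformNode p → ℝ, H.IsUPHEC p c → H.IsUPHEC p c' →
        ∃ a : ℝ, 0 < a ∧ c' = a • c := by
  have hirr := hconn.uniformise hE hne p
  have hN : Nonempty (H.UniformNode p) := hconn.1.elim fun v hv => ⟨Sum.inl ⟨v, hv⟩⟩
  exact ⟨hirr,
    (H.uniformise p).adjTensor_isSymm.exists_isPositiveHEigenvector
      H.uniformise_adjTensor_nonneg hirr,
    fun _ _ hc hc' => hc.exists_eq_smul H.uniformise_adjTensor_nonneg hirr hc'⟩
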